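/- All graphs are finite and simple. For $n+k\ge 2\delta$ let $H_{n,k,\delta}=K_\delta\vee(K_{n-2\delta+k}\cup I_{\delta-k})$, where $K_s$ is the complete graph on $s$ vertices, $I_t$ is the edgeless graph on $t$ vertices, $\cup$ denotes disjoint union and $\vee$ denotes join. A graph $G$ is called $k$-edge-Hamiltonian if every linear forest (vertex-disjoint union of paths) in $G$ with at most $k$ edges is contained in a Hamilton cycle of $G$, and $k$-Hamiltonian if for every $X\subseteq V(G)$ with $|X|\le k$ the subgraph induced by $V(G)\setminus X$ has a Hamilton cycle. Write $e(G)$ for the number of edges of $G$. Let $\delta>k\ge 0$ be integers. Then there is an integer $N$, depending only on $k$ and $\delta$, such that the following holds for every $n\ge N$. If $G$ is an $n$-vertex graph with minimum degree at least $\delta$ and $e(G)\ge e(H_{n,k,\delta})$, then $G$ is both $k$-edge-Hamiltonian and $k$-Hamiltonian, unless $G$ is isomorphic to $H_{n,k,\delta}$. -/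

import Mathlib

namespace SimpleGraph

universe u v

/-- The join `G ∨ H`: the disjoint union of `G` and `H` together with all edges between them. -/
def joinGraph {V : Type u} {W : Type v} (G : SimpleGraph V) (H : SimpleGraph W) :
    SimpleGraph (V ⊕ W) :=
  (G ⊕g H) ⊔ completeBipartiteGraph V W

/-- The graph `H_{n,k,δ} = K_δ ∨ (K_{n-2δ+k} ∪ I_{δ-k})`. For `k ≤ δ` and `2δ ≤ n + k` the
truncated subtractions are genuine ones and the graph has `n` vertices. -/
def extremalH (n k δ : ℕ) : SimpleGraph (Fin δ ⊕ (Fin (n + k - 2 * δ) ⊕ Fin (δ - k))) :=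
  joinGraph (completeGraph (Fin δ))
    (completeGraph (Fin (n + k - 2 * δ)) ⊕g emptyGraph (Fin (δ - k)))

/-- A linear forest: every connected component is a path (possibly a single vertex), i.e. the
graph is a vertex-disjoint union of paths. -/
def IsLinearForest {V : Type u} (F : SimpleGraph V) : Prop :=
  ∀ c : F.ConnectedComponent, ∃ m : ℕ, Nonempty (c.toSimpleGraph ≃g pathGraph m)

/-- `G` is `k`-edge-Hamiltonian: every linear forest in `G` with at most `k` edges is contained in
a Hamilton cycle of `G`. The linear forest is given as a spanning subgraph `F`; isolated vertices
of `F` play no role. -/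
def IsEdgeHamiltonian {V : Type u} [DecidableEq V] (G : SimpleGraph V) (k : ℕ) : Prop :=
  ∀ F : SimpleGraph V, F ≤ G → F.IsLinearForest → F.edgeSet.encard ≤ k →
    ∃ (a : V) (p : G.Walk a a), p.IsHamiltonianCycle ∧ F.edgeSet ⊆ p.edgeSet

/-- `G` is `k`-Hamiltonian: for every set `X` of at most `k` vertices, the subgraph induced by the
complement of `X` has a Hamilton cycle. (A graph with fewer than three vertices has no Hamilton
cycle.) -/
def IsVertexHamiltonian {V : Type u} [DecidableEq V] (G : SimpleGraph V) (k : ℕ) : Prop :=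
  ∀ X : Finset V, X.card ≤ k →
    ∃ (a : {v : V | v ∉ X}) (p : (G.induce {v : V | v ∉ X}).Walk a a), p.IsHamiltonianCycle

end SimpleGraph

/-! Both properties are stable in the Bondy–Chvátal sense: for nonadjacent u, v with deg u + deg v ≥
n + k, they pass from G + uv to G. Complete graphs of large order have them, so if G fails, a
maximal failing supergraph M on the same vertices is not complete, and every nonadjacent pair in M
has degree sum below n + k. In M take a nonadjacent pair u, v of maximal degree sum with i = deg u ≤
deg v. At least i - k non-neighbours of v have degree at most i, which bounds e(M). For large n the
bound reaches e(H) only if i = δ, and equality forces M ≅ H (`exists_extremal_structure`). Then e(G)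
≥ e(H) = e(M) gives G = M, so G ≅ H. Stability is proved in `exists_isHamiltonianCycle_of_sup_edge`
and its vertex-deleted version; `of_stable_of_extremalH_le` carries the common argument. -/

namespace SimpleGraph

/-! ### Rerouting Hamiltonian paths and cycles; stability under adding an edge. -/

namespace Walk

variable {V : Type*} {G : SimpleGraph V} {u v : V}

theorem exists_eq_append_cons_of_lt_length (p : G.Walk u v) {i : ℕ} (hi : i < p.length) :
    ∃ (x y : V) (h : G.Adj x y) (p₁ : G.Walk u x) (p₂ : G.Walk y v),
      x = p.getVert i ∧ y = p.getVert (i + 1) ∧ p = p₁.append (cons h p₂) := by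
  induction p generalizing i with
  | nil => simp at hi
  | cons h q ih =>
    cases i with
    | zero => exact ⟨_, _, h, nil, q, by simp, by simp, by simp⟩
    | succ i =>
      obtain ⟨x, y, h', p₁, p₂, hx, hy, hq⟩ := ih (i := i) (by simpa using hi)
      exact ⟨x, y, h', cons h p₁, p₂, by simpa using hx, by simpa using hy, by simp [hq]⟩

variable [DecidableEq V]

theorem IsHamiltonian.isHamiltonianCycle_cons [Fintype V] {p : G.Walk u v}
    (hp : p.IsHamiltonian) (h : G.Adj v u) (hV : 3 ≤ Fintype.card V) :
    (cons h p).IsHamiltonianCycle := by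
  have hl := hp.length_eq
  rw [isHamiltonianCycle_iff_isCycle_and_length_eq, cons_isCycle_iff]
  refine ⟨⟨hp.isPath, fun he => ?_⟩, by rw [length_cons]; omega⟩
  have := hp.isPath.length_eq_one_of_mem_edges (Sym2.eq_swap ▸ he)
  omega

theorem IsHamiltonianCycle.exists_isHamiltonian_of_snd_eq {c : G.Walk u u}
    (hc : c.IsHamiltonianCycle) (hv : c.snd = v) :
    ∃ q : G.Walk u v, q.IsHamiltonian ∧ s(u, v) ∉ q.edges ∧
      ∀ e ∈ c.edges, e = s(u, v) ∨ e ∈ q.edges := by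
  cases c with
  | nil => exact absurd hc.isCycle not_isCycle_nil
  | @cons _ w _ h q =>
    obtain rfl : w = v := by simpa using hv
    have ht := hc.isHamiltonian_tail
    have hq : q.IsHamiltonian := by
      intro a
      have := ht a
      simpa using this
    refine ⟨q.reverse, ?_, ?_, ?_⟩
    · intro a
      simpa using hq a
    · simpa using ((cons_isCycle_iff q h).1 hc.isCycle).2
    · intro e he
      simpa using he

theorem IsHamiltonianCycle.exists_isHamiltonian_of_mem_edges {a : V} {c : G.Walk a a}
    (hc : c.IsHamiltonianCycle) (huv : s(u, v) ∈ c.edges) :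
    ∃ q : G.Walk u v, q.IsHamiltonian ∧ s(u, v) ∉ q.edges ∧
      ∀ e ∈ c.edges, e = s(u, v) ∨ e ∈ q.edges := by
  wlog ha : a = u generalizing a
  · have hu : u ∈ c.support := fst_mem_support_of_mem_edges c huv
    have hr := c.rotate_edges u hu
    obtain ⟨q, hq, hq', hq''⟩ := this (hc.rotate hu) (hr.mem_iff.2 huv) rfl
    exact ⟨q, hq, hq', fun e he => hq'' e (hr.mem_iff.2 he)⟩
  subst ha
  by_cases hs : c.snd = v
  · exact hc.exists_isHamiltonian_of_snd_eq hs
  -- A cycle based at u uses only its first and last edges at u, so here uv is the last edge and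
  -- reversing the cycle reduces to the previous case.
  have hpen : v = c.penultimate := by
    have hn := hc.isCycle.not_nil
    cases c with
    | nil => exact absurd hc.isCycle not_isCycle_nil
    | @cons _ w _ h q =>
      have hq := ((cons_isCycle_iff q h).1 hc.isCycle).1
      have hvw : v ≠ w := fun e => hs (by simp [e])
      have hm : s(a, v) ∈ q.edges := by
        rw [edges_cons, List.mem_cons] at huv
        exact huv.resolve_left fun e => hvw (Sym2.congr_right.1 e)
      have := hq.eq_penultimate_of_mem_edges hm
      rw [penultimate_cons_of_not_nil]
      · exact this
      · intro h0
        rw [← edges_eq_nil] at h0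
        simp [h0] at hm
  have : Finite V := hc.finite
  have := Fintype.ofFinite V
  have hcr : c.reverse.IsHamiltonianCycle := by
    rw [isHamiltonianCycle_iff_isCycle_and_length_eq] at hc ⊢
    exact ⟨hc.1.reverse, by simpa using hc.2⟩
  obtain ⟨q, hq, hq', hq''⟩ := hcr.exists_isHamiltonian_of_snd_eq (v := v) (by simp [hpen])
  exact ⟨q, hq, hq', fun e he => hq'' e (by simpa using he)⟩

/-- Closing a Hamiltonian path through a crossing pair of chords. -/
theorem IsHamiltonian.exists_isHamiltonianCycle_of_crossing [Fintype V] {p : G.Walk u v}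
    (hp : p.IsHamiltonian) (hV : 3 ≤ Fintype.card V) {i : ℕ} (hi : i < p.length)
    (h₁ : G.Adj u (p.getVert (i + 1))) (h₂ : G.Adj v (p.getVert i)) :
    ∃ (a : V) (c : G.Walk a a), c.IsHamiltonianCycle ∧
      ∀ e ∈ p.edges, e ≠ s(p.getVert i, p.getVert (i + 1)) → e ∈ c.edges := by
  obtain ⟨x, y, h, p₁, p₂, hx, hy, hpe⟩ := p.exists_eq_append_cons_of_lt_length hi
  rw [← hx] at h₂ ⊢
  rw [← hy] at h₁ ⊢
  have hq : (p₁.append (cons h₂.symm p₂.reverse)).IsHamiltonian := by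
    intro a
    have := hp a
    rw [hpe, support_append] at this
    rw [support_append]
    simpa using this
  refine ⟨_, _, hq.isHamiltonianCycle_cons h₁.symm hV, fun e he hne => ?_⟩
  rw [hpe] at he
  simp only [edges_append, edges_cons, List.mem_append, List.mem_cons, edges_reverse,
    List.mem_reverse] at he ⊢
  tauto

open Finset in
theorem IsHamiltonian.card_filter_adj_getVert [Fintype V] [DecidableRel G.Adj] {p : G.Walk u v}
    (hp : p.IsHamiltonian) :
    #{i ∈ range p.length | G.Adj v (p.getVert i)} = G.degree v := by
  rw [← card_neighborFinset_eq_degree]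
  refine card_bij (fun i _ => p.getVert i) (by simp) ?_ ?_
  · intro i hi j hj hij
    simp only [mem_filter, mem_range] at hi hj
    exact hp.isPath.getVert_injOn (by simp; omega) (by simp; omega) hij
  · intro w hw
    obtain ⟨i, hi, hi'⟩ := mem_support_iff_exists_getVert.1 (hp.mem_support w)
    rw [mem_neighborFinset] at hw
    refine ⟨i, ?_, hi⟩
    simp only [mem_filter, mem_range, hi, hw, and_true]
    refine lt_of_le_of_ne hi' fun h => hw.ne ?_
    rw [← hi, h, getVert_length]

open Finset in
theorem IsHamiltonian.card_filter_adj_getVert_succ [Fintype V] [DecidableRel G.Adj]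
    {p : G.Walk u v} (hp : p.IsHamiltonian) :
    #{i ∈ range p.length | G.Adj u (p.getVert (i + 1))} = G.degree u := by
  rw [← card_neighborFinset_eq_degree]
  refine card_bij (fun i _ => p.getVert (i + 1)) (by simp) ?_ ?_
  · intro i hi j hj hij
    simp only [mem_filter, mem_range] at hi hj
    have := hp.isPath.getVert_injOn (by simp; omega) (by simp; omega) hij
    omega
  · intro w hw
    obtain ⟨i, hi, hi'⟩ := mem_support_iff_exists_getVert.1 (hp.mem_support w)
    rw [mem_neighborFinset] at hw
    obtain _ | i := i
    · exact absurd (by simpa using hi) hw.ne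
    exact ⟨i, by simp [hi, hw]; omega, hi⟩

-- Pigeonhole on the n - 1 path edges: deg u of them satisfy the condition at u and deg v the one at
-- v, so at least k + 1 satisfy both, and E contains at most k of these.
open Finset in
theorem IsHamiltonian.exists_crossing [Fintype V] [DecidableRel G.Adj]
    {p : G.Walk u v} (hp : p.IsHamiltonian) {E : Set (Sym2 V)} {k : ℕ} (hE : E.encard ≤ k)
    (hdeg : Fintype.card V + k ≤ G.degree u + G.degree v) :
    ∃ i < p.length, G.Adj u (p.getVert (i + 1)) ∧ G.Adj v (p.getVert i) ∧
      s(p.getVert i, p.getVert (i + 1)) ∉ E := by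
  classical
  by_contra! hcon
  set A := {i ∈ range p.length | G.Adj u (p.getVert (i + 1))} with hA
  set T := {i ∈ range p.length | G.Adj v (p.getVert i)} with hT
  have hAc : #A = G.degree u := hp.card_filter_adj_getVert_succ
  have hTc : #T = G.degree v := hp.card_filter_adj_getVert
  have hfin : E.Finite := Set.finite_of_encard_le_coe hE
  have hEk : hfin.toFinset.card ≤ k := by
    rw [hfin.encard_eq_coe_toFinset_card] at hE
    exact_mod_cast hE
  have hinter : #(A ∩ T) ≤ k := by
    refine le_trans ?_ hEk
    refine card_le_card_of_injOn (fun i => s(p.getVert i, p.getVert (i + 1))) ?_ ?_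
    · intro i hi
      simp only [coe_inter, Set.mem_inter_iff, mem_coe, hA, hT, mem_filter, mem_range] at hi
      simpa using hcon i hi.1.1 hi.1.2 hi.2.2
    · intro i hi j hj hij
      simp only [coe_inter, Set.mem_inter_iff, mem_coe, hA, hT, mem_filter, mem_range] at hi hj
      have inj : ∀ a b, a ≤ p.length → b ≤ p.length → p.getVert a = p.getVert b → a = b :=
        fun a b ha hb h => hp.isPath.getVert_injOn ha hb h
      simp only [Sym2.eq_iff] at hij
      rcases hij with ⟨h, -⟩ | ⟨h, h'⟩
      · exact inj _ _ (by omega) (by omega) h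
      · have h1 := inj _ _ (by omega) (by omega) h
        have h2 := inj _ _ (by omega) (by omega) h'
        omega
  have hunion : #(A ∪ T) ≤ p.length := by
    refine (card_le_card (union_subset (filter_subset _ _) (filter_subset _ _))).trans ?_
    simp
  have := card_union_add_card_inter A T
  have hl := hp.length_eq
  have : 0 < Fintype.card V := Fintype.card_pos_iff.2 ⟨u⟩
  omega

end Walk

/-- Bondy–Chvátal stability of having a Hamiltonian cycle through a prescribed edge set. -/
theorem exists_isHamiltonianCycle_of_sup_edge {V : Type*} [Fintype V] [DecidableEq V]
    {G : SimpleGraph V} [DecidableRel G.Adj] {E : Set (Sym2 V)} {k : ℕ} {u v : V}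
    (hV : 3 ≤ Fintype.card V) (hEG : E ⊆ G.edgeSet) (hE : E.encard ≤ k) (huv : ¬ G.Adj u v)
    (hdeg : Fintype.card V + k ≤ G.degree u + G.degree v)
    (h : ∃ (a : V) (c : (G ⊔ edge u v).Walk a a), c.IsHamiltonianCycle ∧ E ⊆ c.edgeSet) :
    ∃ (a : V) (c : G.Walk a a), c.IsHamiltonianCycle ∧ E ⊆ c.edgeSet := by
  obtain ⟨a, c, hc, hEc⟩ := h
  have hadj : ∀ e ∈ (G ⊔ edge u v).edgeSet, e ≠ s(u, v) → e ∈ G.edgeSet := by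
    intro e he hne
    rw [edgeSet_sup] at he
    refine he.resolve_right fun he' => hne ?_
    rw [edge, edgeSet_fromEdgeSet] at he'
    exact he'.1
  by_cases hm : s(u, v) ∈ c.edges
  · obtain ⟨q, hq, hq', hq''⟩ := hc.exists_isHamiltonian_of_mem_edges hm
    have hqG : ∀ e ∈ q.edges, e ∈ G.edgeSet := fun e he =>
      hadj e (q.edges_subset_edgeSet he) fun h => hq' (h ▸ he)
    have hr : (q.transfer G hqG).IsHamiltonian := fun b => by simpa using hq b
    obtain ⟨i, hi, h1, h2, h3⟩ := hr.exists_crossing hE hdeg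
    obtain ⟨b, c', hc', hcc⟩ := hr.exists_isHamiltonianCycle_of_crossing hV hi h1 h2
    refine ⟨b, c', hc', fun e he => hcc e ?_ fun h => h3 (h ▸ he)⟩
    rw [Walk.edges_transfer]
    refine (hq'' e (hEc he)).resolve_left fun h => huv ?_
    exact hEG (h ▸ he)
  · have hcG : ∀ e ∈ c.edges, e ∈ G.edgeSet := fun e he =>
      hadj e (c.edges_subset_edgeSet he) fun h => hm (h ▸ he)
    refine ⟨a, c.transfer G hcG, ?_, by simpa using hEc⟩
    rw [Walk.isHamiltonianCycle_iff_isCycle_and_length_eq] at hc ⊢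
    exact ⟨hc.1.transfer hcG, by simpa using hc.2⟩

end SimpleGraph

/-! ### Linear forests as orderings of the vertex set. -/

namespace SimpleGraph

theorem ConnectedComponent.exists_list_of_iso_pathGraph {V : Type*} {F : SimpleGraph V}
    (c : F.ConnectedComponent) {m : ℕ} (φ : c.toSimpleGraph ≃g pathGraph m) :
    ∃ l : List V, l.Nodup ∧ (∀ w, w ∈ l ↔ F.connectedComponentMk w = c) ∧
      ∀ x y, F.Adj x y → x ∈ l → [x, y] <:+: l ∨ [y, x] <:+: l := by
  set l : List V := List.ofFn fun i => (φ.symm i : V) with hl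
  have hmem : ∀ w, w ∈ l ↔ F.connectedComponentMk w = c := by
    intro w
    rw [hl, List.mem_ofFn]
    constructor
    · rintro ⟨i, rfl⟩
      exact (φ.symm i).2
    · intro h
      exact ⟨φ ⟨w, h⟩, by simp⟩
  have hget : ∀ i j : Fin m, i.val + 1 = j.val → [(φ.symm i : V), (φ.symm j : V)] <:+: l := by
    intro i j hij
    refine ⟨l.take i, l.drop (i + 2), ?_⟩
    have hlen : l.length = m := by simp [hl]
    have h1 : l[i.val]'(by omega) = (φ.symm i : V) := by simp [hl]
    have h2 : l[i.val + 1]'(by omega) = (φ.symm j : V) := by simp [hl, hij]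
    rw [← h1, ← h2, List.append_assoc, List.cons_append, List.cons_append, List.nil_append]
    rw [List.cons_getElem_drop_succ, List.cons_getElem_drop_succ, List.take_append_drop]
  refine ⟨l, ?_, hmem, ?_⟩
  · rw [hl, List.nodup_ofFn]
    exact Subtype.val_injective.comp φ.symm.injective
  · intro x y hxy hx
    have hx' := (hmem x).1 hx
    have hy' : F.connectedComponentMk y = c := by
      rw [← hx']
      exact (ConnectedComponent.connectedComponentMk_eq_of_adj hxy).symm
    have ha : (pathGraph m).Adj (φ ⟨x, hx'⟩) (φ ⟨y, hy'⟩) := by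
      rw [φ.map_adj_iff]
      exact (c.toSimpleGraph_adj hx' hy').2 hxy
    rw [pathGraph_adj] at ha
    rcases ha with ha | ha
    · left
      simpa using hget _ _ ha
    · right
      simpa using hget _ _ ha

/-- Each component is listed along its path and the lists are concatenated. Adjacency is recorded as
an infix of length two because infixes survive concatenation. -/
theorem IsLinearForest.exists_list {V : Type*} [Finite V] {F : SimpleGraph V}
    (hF : F.IsLinearForest) :
    ∃ l : List V, l.Nodup ∧ (∀ w, w ∈ l) ∧
      ∀ x y, F.Adj x y → [x, y] <:+: l ∨ [y, x] <:+: l := by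
  classical
  have := Fintype.ofFinite V
  have h : ∀ c : F.ConnectedComponent, ∃ l : List V, l.Nodup ∧
      (∀ w, w ∈ l ↔ F.connectedComponentMk w = c) ∧
      ∀ x y, F.Adj x y → x ∈ l → [x, y] <:+: l ∨ [y, x] <:+: l := fun c => by
    obtain ⟨m, ⟨φ⟩⟩ := hF c
    exact c.exists_list_of_iso_pathGraph φ
  choose L hnd hmem hadj using h
  refine ⟨(Finset.univ : Finset F.ConnectedComponent).toList.flatMap L, ?_, ?_, ?_⟩
  · rw [List.nodup_flatMap]
    refine ⟨fun c _ => hnd c, (Finset.nodup_toList _).imp fun {c d} hcd => ?_⟩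
    intro w hw hw'
    exact hcd (((hmem c w).1 hw).symm.trans ((hmem d w).1 hw'))
  · intro w
    rw [List.mem_flatMap]
    exact ⟨F.connectedComponentMk w, by simp, (hmem _ w).2 rfl⟩
  · intro x y hxy
    have hinf : L (F.connectedComponentMk x) <:+:
        (Finset.univ : Finset F.ConnectedComponent).toList.flatMap L :=
      List.infix_of_mem_flatten
        (List.mem_map_of_mem (Finset.mem_toList.2 (Finset.mem_univ _)))
    exact (hadj _ x y hxy ((hmem _ x).2 rfl)).imp (·.trans hinf) (·.trans hinf)

/-- A linear forest on at least three vertices extends to a Hamiltonian cycle of the complete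
graph. -/
theorem IsLinearForest.exists_isHamiltonianCycle_top {V : Type*} [Fintype V] [DecidableEq V]
    {F : SimpleGraph V} (hF : F.IsLinearForest) (hV : 3 ≤ Fintype.card V) :
    ∃ (a : V) (p : (⊤ : SimpleGraph V).Walk a a), p.IsHamiltonianCycle ∧
      F.edgeSet ⊆ p.edgeSet := by
  obtain ⟨l, hnd, hmem, hadj⟩ := hF.exists_list
  have hne : l ≠ [] := by
    rintro rfl
    obtain ⟨v⟩ : Nonempty V := Fintype.card_pos_iff.1 (by omega)
    simpa using hmem v
  have hchain : l.IsChain (⊤ : SimpleGraph V).Adj :=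
    List.Pairwise.isChain (hnd.imp fun h => (top_adj _ _).2 h)
  set q := Walk.ofSupport l hne hchain with hq
  have hsup : q.support = l := Walk.support_ofSupport hne hchain
  have hqH : q.IsHamiltonian := by
    refine Walk.IsPath.isHamiltonian_of_mem (Walk.IsPath.mk' (by rwa [hsup])) fun w => ?_
    rw [hsup]
    exact hmem w
  have hends : (⊤ : SimpleGraph V).Adj (l.getLast hne) (l.head hne) := by
    rw [top_adj]
    intro he
    have := hqH.isPath.nil_iff_eq.2 he.symm
    have h0 := this.length_eq_zero
    have := hqH.length_eq
    omega
  refine ⟨_, Walk.cons hends q, hqH.isHamiltonianCycle_cons hends hV, ?_⟩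
  intro e he
  induction e with
  | _ x y =>
    rw [Walk.mem_edgeSet, Walk.edges_cons, List.mem_cons]
    right
    rw [← Walk.infix_support_iff_mem_edges, hsup]
    exact hadj x y he

end SimpleGraph

/-! ### Degree sums and the structure forced by equality. -/

namespace SimpleGraph

open Finset

theorem card_filter_adj_le {V : Type*} [DecidableEq V] (G : SimpleGraph V) [DecidableRel G.Adj]
    (B : Finset V) {b : V} (hb : b ∈ B) :
    #{w ∈ B | G.Adj b w} ≤ #B - 1 := by
  rw [← card_erase_of_mem hb]
  refine card_le_card fun w hw => ?_
  rw [mem_filter] at hw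
  exact mem_erase.2 ⟨hw.2.ne', hw.1⟩

variable {V : Type*} [Fintype V] [DecidableEq V] (G : SimpleGraph V) [DecidableRel G.Adj]

theorem degree_eq_card_filter_add_card_filter_compl (A : Finset V) (v : V) :
    G.degree v = #{w ∈ A | G.Adj v w} + #{w ∈ Aᶜ | G.Adj v w} := by
  rw [← card_neighborFinset_eq_degree, ← card_union_of_disjoint]
  · congr 1
    ext w
    simp only [mem_neighborFinset, mem_union, mem_filter, mem_compl]
    tauto
  · exact disjoint_filter_filter disjoint_compl_right

/-- The edges between A and its complement are counted from both sides. The edges inside A stand on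
the left, to avoid subtraction; dropping them gives the upper bound, and in the equality case they
must vanish. -/
theorem sum_degree_add_sum_card_filter (A : Finset V) :
    ∑ v, G.degree v + ∑ a ∈ A, #{w ∈ A | G.Adj a w} =
      2 * ∑ a ∈ A, G.degree a + ∑ b ∈ Aᶜ, #{w ∈ Aᶜ | G.Adj b w} := by
  have hcross : ∑ b ∈ Aᶜ, #{w ∈ A | G.Adj b w} = ∑ a ∈ A, #{w ∈ Aᶜ | G.Adj a w} := by
    simp_rw [card_filter]
    rw [sum_comm]
    simp_rw [G.adj_comm]
  have hA : ∑ a ∈ A, G.degree a =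
      ∑ a ∈ A, #{w ∈ A | G.Adj a w} + ∑ a ∈ A, #{w ∈ Aᶜ | G.Adj a w} := by
    rw [← sum_add_distrib]
    exact sum_congr rfl fun a _ => G.degree_eq_card_filter_add_card_filter_compl A a
  have hB : ∑ b ∈ Aᶜ, G.degree b =
      ∑ b ∈ Aᶜ, #{w ∈ A | G.Adj b w} + ∑ b ∈ Aᶜ, #{w ∈ Aᶜ | G.Adj b w} := by
    rw [← sum_add_distrib]
    exact sum_congr rfl fun a _ => G.degree_eq_card_filter_add_card_filter_compl A a
  rw [← sum_add_sum_compl A]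
  omega

variable {G}

theorem sum_degree_le_of_forall_degree_le {A : Finset V} {i : ℕ} (hA : ∀ a ∈ A, G.degree a ≤ i) :
    ∑ v, G.degree v ≤ 2 * (#A * i) + #Aᶜ * (#Aᶜ - 1) := by
  have h := G.sum_degree_add_sum_card_filter A
  have h1 : ∑ a ∈ A, G.degree a ≤ #A * i := sum_le_card_nsmul _ _ _ hA
  have h2 : ∑ b ∈ Aᶜ, #{w ∈ Aᶜ | G.Adj b w} ≤ #Aᶜ * (#Aᶜ - 1) :=
    sum_le_card_nsmul _ _ _ fun b hb => G.card_filter_adj_le _ hb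
  omega

/-- The equality case of `sum_degree_le_of_forall_degree_le`. -/
theorem structure_of_sum_degree_le {A : Finset V} {i : ℕ} (hA : ∀ a ∈ A, G.degree a ≤ i)
    (h : 2 * (#A * i) + #Aᶜ * (#Aᶜ - 1) ≤ ∑ v, G.degree v) :
    (∀ a ∈ A, G.degree a = i) ∧ (∀ a ∈ A, ∀ b ∈ A, ¬ G.Adj a b) ∧
      ∀ a ∉ A, ∀ b ∉ A, a ≠ b → G.Adj a b := by
  have h0 := G.sum_degree_add_sum_card_filter A
  have h1 : ∑ a ∈ A, G.degree a ≤ #A * i := sum_le_card_nsmul _ _ _ hA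
  have h2' : ∀ b ∈ Aᶜ, #{w ∈ Aᶜ | G.Adj b w} ≤ #Aᶜ - 1 := fun b hb => G.card_filter_adj_le _ hb
  have h2 : ∑ b ∈ Aᶜ, #{w ∈ Aᶜ | G.Adj b w} ≤ #Aᶜ * (#Aᶜ - 1) := sum_le_card_nsmul _ _ _ h2'
  refine ⟨?_, ?_, ?_⟩
  · refine (sum_eq_sum_iff_of_le hA).1 ?_
    rw [sum_const, smul_eq_mul]
    omega
  · intro a ha b hb hab
    have hz : ∑ a ∈ A, #{w ∈ A | G.Adj a w} = 0 := by omega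
    rw [sum_eq_zero_iff] at hz
    have := hz a ha
    rw [card_eq_zero, filter_eq_empty_iff] at this
    exact this hb hab
  · have he := (sum_eq_sum_iff_of_le h2').1 (by rw [sum_const, smul_eq_mul]; omega)
    intro a ha b hb hab
    have ha' : a ∈ Aᶜ := mem_compl.2 ha
    have hs : ({w ∈ Aᶜ | G.Adj a w} : Finset V) = Aᶜ.erase a := by
      refine eq_of_subset_of_card_le (fun w hw => ?_) ?_
      · rw [mem_filter] at hw
        exact mem_erase.2 ⟨hw.2.ne', hw.1⟩
      · rw [card_erase_of_mem ha', he a ha']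
    have : b ∈ Aᶜ.erase a := mem_erase.2 ⟨hab.symm, mem_compl.2 hb⟩
    rw [← hs, mem_filter] at this
    exact this.2

/-- Among graphs which are closed under the Bondy–Chvátal closure with parameter `n + k`, the
edge bound forces the extremal structure. -/
theorem exists_extremal_structure {k δ : ℕ} (hkδ : k < δ) (hn : 6 * δ + 6 ≤ Fintype.card V)
    (hδ : ∀ v, δ ≤ G.degree v) (htop : G ≠ ⊤)
    (hcl : ∀ u v, u ≠ v → ¬ G.Adj u v → G.degree u + G.degree v < Fintype.card V + k)
    (hE : 2 * ((δ - k) * δ) + (Fintype.card V - (δ - k)) * (Fintype.card V - (δ - k) - 1) ≤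
      ∑ v, G.degree v) :
    ∃ W A : Finset V, Disjoint W A ∧ #W = δ ∧ #A = δ - k ∧
      ∀ x y, G.Adj x y ↔ x ≠ y ∧ (x ∈ W ∨ y ∈ W ∨ (x ∉ A ∧ y ∉ A)) := by
  set n := Fintype.card V with hnV
  obtain ⟨u, v, huv, hadj, hle, hmax⟩ : ∃ u v, u ≠ v ∧ ¬ G.Adj u v ∧ G.degree u ≤ G.degree v ∧
      ∀ x y, x ≠ y → ¬ G.Adj x y → G.degree x + G.degree y ≤ G.degree u + G.degree v := by
    obtain ⟨x, y, hxy, hna⟩ : ∃ x y, x ≠ y ∧ ¬ G.Adj x y := by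
      by_contra! hc
      exact htop (by ext x y; exact ⟨fun h => h.ne, fun h => hc x y h⟩)
    obtain ⟨⟨a, b⟩, hab, hm⟩ := exists_max_image
      ({q : V × V | q.1 ≠ q.2 ∧ ¬ G.Adj q.1 q.2} : Finset (V × V))
      (fun q => G.degree q.1 + G.degree q.2) ⟨(x, y), by simp [hxy, hna]⟩
    simp only [mem_filter, mem_univ, true_and] at hab hm
    rcases le_total (G.degree a) (G.degree b) with h | h
    · exact ⟨a, b, hab.1, hab.2, h, fun x y h1 h2 => hm (x, y) ⟨h1, h2⟩⟩
    · refine ⟨b, a, hab.1.symm, fun h => hab.2 h.symm, h, fun x y h1 h2 => ?_⟩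
      rw [add_comm (G.degree b)]
      exact hm (x, y) ⟨h1, h2⟩
  set i := G.degree u with hi
  have hsum := hcl u v huv hadj
  have hiδ : δ ≤ i := hδ u
  have hcard : ∀ w, #({x | x ≠ w ∧ ¬ G.Adj w x} : Finset V) + G.degree w + 1 = n := by
    intro w
    have h1 : ({x | x ≠ w ∧ ¬ G.Adj w x} : Finset V) = (insert w (G.neighborFinset w))ᶜ := by
      ext x
      simp
    rw [h1, card_compl, card_insert_of_notMem (by simp), card_neighborFinset_eq_degree]
    have := G.degree_lt_card_verts w
    omega
  have hLd : ∀ x ∈ ({x | x ≠ v ∧ ¬ G.Adj v x} : Finset V), G.degree x ≤ i := by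
    intro x hx
    simp only [mem_filter, mem_univ, true_and] at hx
    have := hmax v x hx.1.symm hx.2
    omega
  -- Since i + deg v ≤ n + k - 1, the n - 1 - deg v non-neighbours of v number at least i - k.
  obtain ⟨A, hAL, hAc⟩ := exists_subset_card_eq
    (show i - k ≤ #({x | x ≠ v ∧ ¬ G.Adj v x} : Finset V) by have := hcard v; omega)
  have hAd : ∀ a ∈ A, G.degree a ≤ i := fun a ha => hLd a (hAL ha)
  have hAcc : #Aᶜ = n - (i - k) := by rw [card_compl, hAc]
  have hid : i = δ := by
    by_contra hne
    have hup := sum_degree_le_of_forall_degree_le hAd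
    rw [hAcc, hAc] at hup
    have hcomb := hE.trans hup
    obtain ⟨s, hs⟩ : ∃ s, δ = k + s := ⟨δ - k, by omega⟩
    obtain ⟨t, ht⟩ : ∃ t, i = δ + t := ⟨i - δ, by omega⟩
    obtain ⟨m, hm⟩ : ∃ m, n = s + t + m + 1 := ⟨n - s - t - 1, by omega⟩
    have e1 : n - (i - k) = m + 1 := by omega
    have e2 : n - (δ - k) = m + t + 1 := by omega
    have e3 : δ - k = s := by omega
    have e4 : i - k = s + t := by omega
    rw [e1, e2, e3, e4, Nat.add_sub_cancel, Nat.add_sub_cancel, ht] at hcomb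
    have htpos : 0 < t := by omega
    -- As 2i ≤ n + k - 1, this holds once n ≥ 6δ - 5k; it is the source of the threshold 6δ + 6. It
    -- contradicts the edge bound after cancelling t = i - δ.
    have hbig : 2 * (s + δ) + t < 2 * m + 1 := by omega
    have hmul : t * (2 * m + t + 1) ≤ t * (2 * (s + δ + t)) := by linarith
    have := Nat.le_of_mul_le_mul_left hmul htpos
    omega
  rw [hid] at hAd hAcc hAc
  obtain ⟨hdeg, hind, hcl'⟩ := structure_of_sum_degree_le hAd (by rw [hAcc, hAc]; exact hE)
  have hNA : ∀ a ∈ A, G.neighborFinset a = G.neighborFinset u := by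
    intro a ha
    refine eq_of_subset_of_card_le ?_ ?_
    · intro b hb
      rw [mem_neighborFinset] at hb ⊢
      have hbA : b ∉ A := fun h => hind a ha b h hb
      by_contra hub
      -- b is adjacent to a and to the rest of the clique `Aᶜ`. If b ≠ u, its degree sum with u is
      -- then at least n + k, which is excluded; b = u is impossible because deg u = δ is too small.
      have hbig : n - (δ - k) ≤ G.degree b := by
        rw [← card_neighborFinset_eq_degree, ← hAcc,
          ← card_erase_add_one (mem_compl.2 hbA)]
        have : insert a (Aᶜ.erase b) ⊆ G.neighborFinset b := by
          intro w hw
          rw [mem_insert, mem_erase, mem_compl] at hw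
          rw [mem_neighborFinset]
          rcases hw with rfl | ⟨h1, h2⟩
          · exact hb.symm
          · exact hcl' b hbA w h2 h1.symm
        have h2 := card_le_card this
        rwa [card_insert_of_notMem (by simp [ha])] at h2
      rcases eq_or_ne u b with rfl | hne
      · omega
      · have := hmax u b hne hub
        omega
    · rw [card_neighborFinset_eq_degree, card_neighborFinset_eq_degree, hdeg a ha, ← hi, hid]
  obtain ⟨a₀, ha₀⟩ : A.Nonempty := card_pos.1 (by omega)
  have hWA : ∀ w ∈ G.neighborFinset u, w ∉ A := by
    intro w hw hwA
    rw [← hNA a₀ ha₀, mem_neighborFinset] at hw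
    exact hind a₀ ha₀ w hwA hw
  refine ⟨G.neighborFinset u, A, Finset.disjoint_left.2 hWA, ?_, hAc, ?_⟩
  · rw [card_neighborFinset_eq_degree, ← hi, hid]
  · intro x y
    by_cases hxA : x ∈ A
    · have h1 : G.Adj x y ↔ y ∈ G.neighborFinset u := by rw [← hNA x hxA, mem_neighborFinset]
      have h2 : x ∉ G.neighborFinset u := fun h => hWA x h hxA
      constructor
      · exact fun h => ⟨h.ne, .inr (.inl (h1.1 h))⟩
      · rintro ⟨-, h | h | h⟩
        · exact absurd h h2
        · exact h1.2 h
        · exact absurd hxA h.1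
    · by_cases hyA : y ∈ A
      · have h1 : G.Adj x y ↔ x ∈ G.neighborFinset u := by
          rw [← hNA y hyA, mem_neighborFinset, adj_comm]
        have h2 : y ∉ G.neighborFinset u := fun h => hWA y h hyA
        constructor
        · exact fun h => ⟨h.ne, .inl (h1.1 h)⟩
        · rintro ⟨-, h | h | h⟩
          · exact h1.2 h
          · exact absurd h h2
          · exact absurd hyA h.2
      · exact ⟨fun h => ⟨h.ne, .inr (.inr ⟨hxA, hyA⟩)⟩, fun h => hcl' x hxA y hyA h.1⟩

end SimpleGraph

/-! ### Identifying the extremal graph, and the maximal counterexample argument. -/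

namespace SimpleGraph

open Finset

theorem nonempty_iso_extremalH {V : Type*} [Fintype V] [DecidableEq V] {G : SimpleGraph V}
    {k δ : ℕ} (hkδ : k ≤ δ) (hn : 2 * δ ≤ Fintype.card V + k) {W A : Finset V}
    (hWA : Disjoint W A) (hW : #W = δ) (hA : #A = δ - k)
    (hadj : ∀ x y, G.Adj x y ↔ x ≠ y ∧ (x ∈ W ∨ y ∈ W ∨ (x ∉ A ∧ y ∉ A))) :
    Nonempty (G ≃g extremalH (Fintype.card V) k δ) := by
  have hR : #(W ∪ A)ᶜ = Fintype.card V + k - 2 * δ := by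
    rw [card_compl, card_union_of_disjoint hWA, hW, hA]
    omega
  set eW := (W.equivFinOfCardEq hW).symm
  set eA := (A.equivFinOfCardEq hA).symm
  set eR := ((W ∪ A)ᶜ.equivFinOfCardEq hR).symm
  set f : Fin δ ⊕ (Fin (Fintype.card V + k - 2 * δ) ⊕ Fin (δ - k)) → V :=
    Sum.elim (fun i => eW i) (Sum.elim (fun i => eR i) fun i => eA i) with hf
  have hWn : ∀ i, (eW i : V) ∉ A := fun i => Finset.disjoint_left.1 hWA (eW i).2
  have hAn : ∀ i, (eA i : V) ∉ W := fun i => Finset.disjoint_right.1 hWA (eA i).2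
  have hRW : ∀ i, (eR i : V) ∉ W := fun i h => mem_compl.1 (eR i).2 (mem_union_left _ h)
  have hRA : ∀ i, (eR i : V) ∉ A := fun i h => mem_compl.1 (eR i).2 (mem_union_right _ h)
  have hWW : ∀ i, (eW i : V) ∈ W := fun i => (eW i).2
  have hAA : ∀ i, (eA i : V) ∈ A := fun i => (eA i).2
  have hinj : Function.Injective f := by
    refine Function.Injective.sumElim (Subtype.val_injective.comp eW.injective)
      (Function.Injective.sumElim (Subtype.val_injective.comp eR.injective)
        (Subtype.val_injective.comp eA.injective) ?_) ?_
    · exact fun i j h => hRA i (h ▸ hAA j)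
    · rintro i (j | j) h
      · exact hRW j ((show (eW i : V) = eR j from h) ▸ hWW i)
      · exact hAn j ((show (eW i : V) = eA j from h) ▸ hWW i)
  have hbij : Function.Bijective f := by
    rw [Fintype.bijective_iff_injective_and_card]
    refine ⟨hinj, ?_⟩
    simp only [Fintype.card_sum, Fintype.card_fin]
    omega
  refine ⟨RelIso.symm ⟨Equiv.ofBijective f hbij, ?_⟩⟩
  intro x y
  rw [Equiv.ofBijective_apply, Equiv.ofBijective_apply, hadj, hinj.ne_iff]
  rcases x with x | x | x <;> rcases y with y | y | y <;>
    simp [hf, extremalH, joinGraph, hWn, hAn, hRW, hRA, hWW, hAA]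

theorem le_two_mul_ncard_edgeSet_extremalH {n k δ : ℕ} (hkδ : k ≤ δ) (hn : 2 * δ ≤ n + k) :
    2 * ((δ - k) * δ) + (n - (δ - k)) * (n - (δ - k) - 1) ≤
      2 * (extremalH n k δ).edgeSet.ncard := by
  classical
  rw [← coe_edgeFinset, Set.ncard_coe_finset, ← sum_degrees_eq_twice_card_edges]
  have hdeg : ∀ v, (extremalH n k δ).degree v =
      ∑ w, if (extremalH n k δ).Adj v w then 1 else 0 := fun v => by
    rw [← card_filter, ← card_neighborFinset_eq_degree, neighborFinset_eq_filter]
  have hadj : ∀ x y, (extremalH n k δ).Adj x y ↔ x ≠ y ∧ (x.isLeft ∨ y.isLeft ∨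
      ((∃ i, x = .inr (.inl i)) ∧ ∃ j, y = .inr (.inl j))) := by
    rintro (x | x | x) (y | y | y) <;> simp [extremalH, joinGraph]
  have hsum : ∀ m : ℕ, ∀ x : Fin m, ∑ y, (if x = y then 0 else 1) = m - 1 := fun m x => by
    rw [sum_ite, sum_const_zero, zero_add, ← card_eq_sum_ones, filter_ne, card_erase_of_mem (mem_univ x), card_univ, Fintype.card_fin]
  obtain ⟨s, rfl⟩ : ∃ s, δ = k + s := ⟨δ - k, by omega⟩
  obtain ⟨r, rfl⟩ : ∃ r, n = k + 2 * s + r := ⟨n - k - 2 * s, by omega⟩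
  have e1 : k + 2 * s + r - s = k + s + r := by omega
  have e2 : k + 2 * s + r + k - 2 * (k + s) = r := by omega
  simp_rw [hdeg, Fintype.sum_sum_type, hadj]
  simp [hsum, e1, e2]
  -- The case splits remove truncated predecessors.
  obtain _ | a := k + s
  · obtain _ | r := r <;> simp
  · obtain _ | r := r
    · simp
      nlinarith
    · simp
      nlinarith

/-- The degree-sum form of the argument: a Bondy–Chvátal stable property of graphs holds for all
large graphs with at least as many edges as the extremal graph, other than that graph itself. -/
theorem of_stable_of_extremalH_le {V : Type*} [Fintype V] [DecidableEq V] (G : SimpleGraph V)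
    [DecidableRel G.Adj] {k δ : ℕ} (hkδ : k < δ) (hn : 6 * δ + 6 ≤ Fintype.card V)
    (hδ : δ ≤ G.minDegree)
    (hE : (extremalH (Fintype.card V) k δ).edgeSet.ncard ≤ G.edgeSet.ncard)
    (hiso : ¬ Nonempty (G ≃g extremalH (Fintype.card V) k δ)) (P : SimpleGraph V → Prop)
    (htop : P ⊤)
    (hstab : ∀ (G' : SimpleGraph V) [DecidableRel G'.Adj], G ≤ G' → ∀ u v, u ≠ v →
      ¬ G'.Adj u v → Fintype.card V + k ≤ G'.degree u + G'.degree v → P (G' ⊔ edge u v) → P G') :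
    P G := by
  classical
  by_contra hPG
  obtain ⟨M, hGM, hM⟩ := (Set.toFinite {G' : SimpleGraph V | ¬ P G'}).exists_le_maximal hPG
  have hPM : ¬ P M := hM.prop
  have hδM : ∀ v, δ ≤ M.degree v := fun v =>
    (hδ.trans (G.minDegree_le_degree v)).trans (degree_le_of_le hGM)
  have hcl : ∀ u v, u ≠ v → ¬ M.Adj u v → M.degree u + M.degree v < Fintype.card V + k := by
    intro u v huv hadj
    by_contra! hd
    refine hPM (hstab M hGM u v huv hadj hd ?_)
    by_contra hP
    have : M ⊔ edge u v ≤ M := hM.le_of_ge hP le_sup_left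
    exact hadj (this (by simp [edge_adj, huv]))
  have hcard := le_two_mul_ncard_edgeSet_extremalH (n := Fintype.card V) hkδ.le (by omega)
  have hGMc : G.edgeSet.ncard ≤ M.edgeSet.ncard :=
    Set.ncard_le_ncard (edgeSet_mono hGM) (Set.toFinite _)
  have hsumM : ∑ v, M.degree v = 2 * M.edgeSet.ncard := by
    rw [sum_degrees_eq_twice_card_edges, ← coe_edgeFinset, Set.ncard_coe_finset]
  obtain ⟨W, A, hWA, hW, hA, hadj⟩ := exists_extremal_structure hkδ hn hδM
    (fun h => hPM (h ▸ htop)) hcl (by omega)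
  obtain ⟨φ⟩ := nonempty_iso_extremalH hkδ.le (by omega) hWA hW hA hadj
  -- Now e(G) ≤ e(M) = e(H) ≤ e(G), so the inclusion G ≤ M is an equality.
  have hMc : M.edgeSet.ncard = (extremalH (Fintype.card V) k δ).edgeSet.ncard :=
    Nat.card_congr φ.mapEdgeSet
  have hGeq : G = M := by
    rw [← edgeSet_inj]
    exact Set.eq_of_subset_of_ncard_le (edgeSet_mono hGM) (by omega) (Set.toFinite _)
  exact hiso (hGeq ▸ ⟨φ⟩)

theorem isLinearForest_bot {V : Type*} : (⊥ : SimpleGraph V).IsLinearForest := by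
  intro c
  refine ⟨1, ⟨?_⟩⟩
  have hs : Subsingleton c := by
    refine ⟨fun x y => Subtype.ext ?_⟩
    have h : (⊥ : SimpleGraph V).connectedComponentMk x.1 =
      (⊥ : SimpleGraph V).connectedComponentMk y.1 := x.2.trans y.2.symm
    exact reachable_bot.1 (ConnectedComponent.exact h)
  have hne : Nonempty c := c.nonempty_supp.to_subtype
  have hu : Unique c := _root_.uniqueOfSubsingleton hne.some
  exact ⟨Equiv.ofUnique c (Fin 1), fun {a b} => by simp [Subsingleton.elim a b]⟩

theorem card_setOf_notMem {V : Type*} [Fintype V] [DecidableEq V] (X : Finset V) :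
    Fintype.card {v : V | v ∉ X} = Fintype.card V - #X :=
  (Fintype.card_of_finset' Xᶜ (by simp)).trans (card_compl X)

/-- Deleting X lowers each degree by at most |X|, so the remaining degree sum is at least n + k -
2|X| ≥ n - |X|, and stability with k = 0 applies. If u or v lies in X, the added edge disappears. -/
theorem exists_isHamiltonianCycle_induce_of_sup_edge {V : Type*} [Fintype V] [DecidableEq V]
    {G : SimpleGraph V} [DecidableRel G.Adj] {k : ℕ} {u v : V} {X : Finset V} (hX : #X ≤ k)
    (hV : k + 3 ≤ Fintype.card V) (huv : ¬ G.Adj u v)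
    (hdeg : Fintype.card V + k ≤ G.degree u + G.degree v)
    (h : ∃ (a : {v : V | v ∉ X}) (p : ((G ⊔ edge u v).induce {v : V | v ∉ X}).Walk a a),
      p.IsHamiltonianCycle) :
    ∃ (a : {v : V | v ∉ X}) (p : (G.induce {v : V | v ∉ X}).Walk a a),
      p.IsHamiltonianCycle := by
  classical
  have hcard : Fintype.card {v : V | v ∉ X} = Fintype.card V - #X :=
    card_setOf_notMem X
  have hd : ∀ (w : V) (hw : w ∉ X),
      G.degree w ≤ (G.induce {v : V | v ∉ X}).degree ⟨w, hw⟩ + #X := by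
    intro w hw
    rw [← card_neighborFinset_eq_degree, ← card_neighborFinset_eq_degree,
      ← card_map (Function.Embedding.subtype _)]
    refine (card_le_card fun x hx => ?_).trans (card_union_le _ _)
    rw [mem_union, mem_map]
    by_cases hxX : x ∈ X
    · exact .inr hxX
    · exact .inl ⟨⟨x, hxX⟩, by simpa using hx, rfl⟩
  by_cases hmem : u ∉ X ∧ v ∉ X
  · obtain ⟨hu, hv⟩ := hmem
    have hind : (G ⊔ edge u v).induce {v : V | v ∉ X} =
        G.induce {v : V | v ∉ X} ⊔ edge ⟨u, hu⟩ ⟨v, hv⟩ := by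
      ext x y
      simp [edge_adj, Subtype.ext_iff]
    rw [hind] at h
    have := hd u hu
    have := hd v hv
    obtain ⟨a, p, hp, -⟩ := exists_isHamiltonianCycle_of_sup_edge (k := 0) (E := ∅)
      (G := G.induce {v : V | v ∉ X}) (u := ⟨u, hu⟩) (v := ⟨v, hv⟩) (by omega) (by simp) (by simp)
      (by simpa using huv) (by omega) (h.imp fun a => Exists.imp fun p hp => ⟨hp, by simp⟩)
    exact ⟨a, p, hp⟩
  · have hind : (G ⊔ edge u v).induce {v : V | v ∉ X} = G.induce {v : V | v ∉ X} := by
      ext ⟨x, hx⟩ ⟨y, hy⟩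
      simp only [comap_adj, sup_adj, edge_adj, Function.Embedding.subtype_apply,
        or_iff_left_iff_imp]
      simp only [Set.mem_ofPred_eq] at hx hy
      rintro ⟨⟨rfl, rfl⟩ | ⟨rfl, rfl⟩, -⟩
      · exact absurd ⟨hx, hy⟩ hmem
      · exact absurd ⟨hy, hx⟩ hmem
    rwa [hind] at h

end SimpleGraph

theorem mainTheorem7 (k δ : ℕ) (hkδ : k < δ) :
    ∃ N : ℕ, ∀ n : ℕ, N ≤ n →
      ∀ (V : Type*) [Fintype V] [DecidableEq V] (G : SimpleGraph V) [DecidableRel G.Adj],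
        Fintype.card V = n →
        δ ≤ G.minDegree →
        (SimpleGraph.extremalH n k δ).edgeSet.ncard ≤ G.edgeSet.ncard →
        ¬ Nonempty (G ≃g SimpleGraph.extremalH n k δ) →
        G.IsEdgeHamiltonian k ∧ G.IsVertexHamiltonian k := by
  refine ⟨6 * δ + 6, ?_⟩
  rintro n hn V _ _ G _ rfl hδ hE hiso
  constructor
  · intro F hFG hF hFk
    refine G.of_stable_of_extremalH_le hkδ hn hδ hE hiso
      (fun G' => ∃ (a : V) (p : G'.Walk a a), p.IsHamiltonianCycle ∧ F.edgeSet ⊆ p.edgeSet)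
      (hF.exists_isHamiltonianCycle_top (by omega)) ?_
    intro G' _ hGG' u v _ hadj hdeg h
    exact SimpleGraph.exists_isHamiltonianCycle_of_sup_edge (by omega)
      (SimpleGraph.edgeSet_mono (hFG.trans hGG')) hFk hadj hdeg h
  · intro X hX
    refine G.of_stable_of_extremalH_le hkδ hn hδ hE hiso
      (fun G' => ∃ (a : {v : V | v ∉ X}) (p : (G'.induce {v : V | v ∉ X}).Walk a a),
        p.IsHamiltonianCycle) ?_ ?_
    · have hcard : Fintype.card {v : V | v ∉ X} = Fintype.card V - X.card :=
        SimpleGraph.card_setOf_notMem X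
      obtain ⟨a, p, hp, -⟩ := SimpleGraph.isLinearForest_bot.exists_isHamiltonianCycle_top
        (V := {v : V | v ∉ X}) (by omega)
      rw [SimpleGraph.induce_top]
      exact ⟨a, p, hp⟩
    · intro G' _ _ u v _ hadj hdeg h
      exact SimpleGraph.exists_isHamiltonianCycle_induce_of_sup_edge hX (by omega) hadj hdeg h
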